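/- Let $0<q<1$, let $m\ge 0$ be an integer, and let $\alpha,b,b_1,\dots,b_m,c_1,\dots,c_m$ be complex numbers. Write $(x;q)_n=\prod_{k=0}^{n-1}(1-xq^k)$, $(x;q)_\infty=\prod_{k=0}^{\infty}(1-xq^k)$, $(x_1,\dots,x_r;q)_n=(x_1;q)_n\cdots(x_r;q)_n$ for $n$ a nonnegative integer or $\infty$, and $${}_r\phi_s\left({x_1,\dots,x_r\atop y_1,\dots,y_s};q,z\right)=\sum_{k=0}^\infty\frac{(x_1,\dots,x_r;q)_k}{(q,y_1,\dots,y_s;q)_k}\left((-1)^kq^{k(k-1)/2}\right)^{1+s-r}z^k.$$ For $\alpha\neq1$ put $$w_n(\alpha)=\frac{(1-\alpha q^{2n})(\alpha;q)_n}{(1-\alpha)(q;q)_n},$$ and for $\alpha=1$ let $w_n(1)=\lim_{\alpha\to1}w_n(\alpha)$, that is, $w_0(1)=1$ and $w_n(1)=1+q^n$ for $n\ge1$. All series over $n$ below converge absolutely. (1) If $a\ne0$ is a complex number with $|\alpha a|<1$, $|\alpha b|<1$, $|\alpha b_j|<1$ and $|\alpha ac_j/q|<1$ for $1\le j\le m$,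 then for every integer $l\ge0$ $$\left(\frac aq\right)^l\frac{(\alpha q,\alpha ab/q;q)_\infty}{(\alpha a,\alpha b;q)_\infty}\prod_{j=1}^m\frac{(\alpha ab_j/q,\alpha c_j;q)_\infty}{(\alpha ac_j/q,\alpha b_j;q)_\infty}=\sum_{n=0}^\infty w_n(\alpha)\frac{(q/a;q)_n(a/q)^n}{(\alpha a;q)_n}\,{}_{m+2}\phi_{m+1}\left({q^{-n},\alpha q^n,\alpha c_1,\dots,\alpha c_m\atop\alpha b,\alpha b_1,\dots,\alpha b_m};q,q^{l+1}\right).$$ (2) In particular ($l=0$), under the same conditions, $$\frac{(\alpha q,\alpha ab/q;q)_\infty}{(\alpha a,\alpha b;q)_\infty}\prod_{j=1}^m\frac{(\alpha ab_j/q,\alpha c_j;q)_\infty}{(\alpha ac_j/q,\alpha b_j;q)_\infty}=\sum_{n=0}^\infty w_n(\alpha)\frac{(q/a;q)_n(a/q)^n}{(\alpha a;q)_n}\,{}_{m+2}\phi_{m+1}\left({q^{-n},\alpha q^n,\alpha c_1,\dots,\alpha c_m\atop\alpha b,\alpha b_1,\dots,\alpha b_m};q,q\right).$$ (3) (The case $a=0$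 of (2).) If $|\alpha b|<1$ and $|\alpha b_j|<1$ for $1\le j\le m$, then $$\frac{(\alpha q;q)_\infty}{(\alpha b;q)_\infty}\prod_{j=1}^m\frac{(\alpha c_j;q)_\infty}{(\alpha b_j;q)_\infty}=\sum_{n=0}^\infty w_n(\alpha)(-1)^nq^{n(n-1)/2}\,{}_{m+2}\phi_{m+1}\left({q^{-n},\alpha q^n,\alpha c_1,\dots,\alpha c_m\atop\alpha b,\alpha b_1,\dots,\alpha b_m};q,q\right).$$ (4) Without any condition on the $c_j$ and $\alpha$, $$(\alpha q;q)_\infty\prod_{j=1}^m(\alpha c_j;q)_\infty=\sum_{n=0}^\infty w_n(\alpha)(-1)^nq^{n(n-1)/2}\,{}_{m+2}\phi_{m+1}\left({q^{-n},\alpha q^n,\alpha c_1,\dots,\alpha c_m\atop0,0,\dots,0};q,q\right).$$ (5) If $|\alpha b|<1$ and $|\alpha b_j|<1$ for $1\le j\le m$, then $$\frac{(\alpha q;q)_\infty}{(\alpha b;q)_\infty\prod_{j=1}^m(\alpha b_j;q)_\infty}=\sum_{n=0}^\infty w_n(\alpha)(-1)^nq^{n(n-1)/2}\,{}_{m+2}\phi_{m+1}\left({q^{-n},\alpha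 q^n,0,\dots,0\atop\alpha b,\alpha b_1,\dots,\alpha b_m};q,q\right).$$ -/

import Mathlib

noncomputable section

/-- The finite `q`-shifted factorial `(a; q)_n = ∏_{k=0}^{n-1} (1 - a q^k)`. -/
def qPoch (a q : ℂ) (n : ℕ) : ℂ := ∏ k ∈ Finset.range n, (1 - a * q ^ k)

/-- The infinite `q`-shifted factorial `(a; q)_∞ = ∏_{k=0}^∞ (1 - a q^k)`; the product converges
for `‖q‖ < 1`, see `qPochInf_hasProd`. -/
def qPochInf (a q : ℂ) : ℂ := ∏' k : ℕ, (1 - a * q ^ k)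

theorem qPochInf_hasProd (a q : ℂ) (hq : ‖q‖ < 1) :
    HasProd (fun k : ℕ => 1 - a * q ^ k) (qPochInf a q) := by
  have h : Summable fun k : ℕ => ‖-(a * q ^ k)‖ := by
    simp only [norm_neg, norm_mul, norm_pow]
    exact (summable_geometric_of_lt_one (norm_nonneg q) hq).mul_left _
  have h2 := (multipliable_one_add_of_summable h).hasProd
  simp only [← sub_eq_add_neg] at h2
  exact h2

/-- The `k`-th term of the basic hypergeometric series `_rφ_s(A; B; q, z)`. -/
def basicHypTerm {r s : ℕ} (A : Fin r → ℂ) (B : Fin s → ℂ) (q z : ℂ) (k : ℕ) : ℂ :=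
  (∏ i, qPoch (A i) q k) / (qPoch q q k * ∏ i, qPoch (B i) q k) *
    ((-1) ^ k * q ^ (k * (k - 1) / 2)) ^ (1 + (s : ℤ) - (r : ℤ)) * z ^ k

/-- The basic hypergeometric series `_rφ_s(A; B; q, z)`. -/
def basicHyp {r s : ℕ} (A : Fin r → ℂ) (B : Fin s → ℂ) (q z : ℂ) : ℂ :=
  ∑' k : ℕ, basicHypTerm A B q z k

/-- The terminating series
`_{m+2}φ_{m+1}(q^{-n}, α q^n, α c_1, …, α c_m; α b, α b_1, …, α b_m; q, z)`. -/
def termPhi {m : ℕ} (q α b : ℂ) (bs cs : Fin m → ℂ) (z : ℂ) (n : ℕ) : ℂ :=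
  basicHyp (r := m + 2) (s := m + 1)
    (Matrix.vecCons (q ^ (-(n : ℤ))) (Matrix.vecCons (α * q ^ n) fun j => α * cs j))
    (Matrix.vecCons (α * b) fun j => α * bs j) q z

/-- The factor `(1 - α q^{2n}) (α; q)_n / ((1 - α) (q; q)_n)`, with the common factor `1 - α`
cancelled: it equals this quotient for `α ≠ 1` (see `wellPoised_eq`), and for `α = 1` it is the
continuous extension, i.e. `1` for `n = 0` and `1 + q^n` for `n ≥ 1`. -/
def wellPoised (α q : ℂ) (n : ℕ) : ℂ :=
  if n = 0 then 1 else (1 - α * q ^ (2 * n)) * qPoch (α * q) q (n - 1) / qPoch q q n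

theorem wellPoised_eq (α q : ℂ) (hα : α ≠ 1) (n : ℕ) :
    wellPoised α q n =
      (1 - α * q ^ (2 * n)) * qPoch α q n / ((1 - α) * qPoch q q n) := by
  have h1 : 1 - α ≠ 0 := sub_ne_zero.mpr hα.symm
  cases n with
  | zero => simp [wellPoised, qPoch, h1]
  | succ n =>
    have h : qPoch α q (n + 1) = (1 - α) * qPoch (α * q) q n := by
      unfold qPoch
      rw [Finset.prod_range_succ', mul_comm]
      congr 1
      · simp
      · exact Finset.prod_congr rfl fun k _ => by ring
    rw [h, wellPoised, if_neg (Nat.succ_ne_zero n), Nat.add_sub_cancel,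
      mul_left_comm, mul_div_mul_left _ _ h1]

end

/-! Both sides of (1) are analytic in `a` on a disc about 0 that contains the given `a`; it suffices
that they agree on a sequence of points tending to 0, namely `a = q ^ (N + 1)`. There `(q / a; q)_n
= (q ^ (-N); q)_n` vanishes for `n > N`, the infinite products collapse to finite ones
(`productSide_pow_succ`), and the claim becomes an inversion formula valid for every sequence `g`
(`bailey_inversion`), proved by a telescoping orthogonality relation.

Analyticity of the series requires locally uniform convergence. The terminating series is `(q; q)_n`
times an `n`-th divided difference at `1, q, …, q ^ n` (`sum_eq_divDiff`). The Leibniz rule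
`divDiff_mul` reduces its growth to that of the single factors: only the numerator parameters `α
c_j` matter, and the bound is `O(σ ^ n)` for each `σ > max |α c_j|` (`exists_norm_sum_le`). Since
`nodePoly` is `O((r / |q|) ^ n)` for `|a| ≤ r`, the condition `|α a c_j / q| < 1` leaves room for a
geometric majorant. The case `a = 0` is an interior point of the disc, so (3)–(5) need no separate
limit. -/

open Filter Topology

/-! ### Finite `q`-shifted factorials. -/

theorem qPoch_zero (a q : ℂ) : qPoch a q 0 = 1 := by simp [qPoch]

theorem qPoch_succ (a q : ℂ) (n : ℕ) : qPoch a q (n + 1) = qPoch a q n * (1 - a * q ^ n) := by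
  simp [qPoch, Finset.prod_range_succ]

theorem qPoch_succ' (a q : ℂ) (n : ℕ) : qPoch a q (n + 1) = (1 - a) * qPoch (a * q) q n := by
  unfold qPoch
  rw [Finset.prod_range_succ', mul_comm]
  congr 1
  · simp
  · exact Finset.prod_congr rfl fun k _ => by ring

theorem qPoch_add (a q : ℂ) (n k : ℕ) :
    qPoch a q (n + k) = qPoch a q n * qPoch (a * q ^ n) q k := by
  unfold qPoch
  rw [Finset.prod_range_add]
  congr 1
  exact Finset.prod_congr rfl fun k _ => by ring

theorem qPoch_ne_zero {a q : ℂ} (h : ∀ k, a * q ^ k ≠ 1) (n : ℕ) : qPoch a q n ≠ 0 :=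
  Finset.prod_ne_zero_iff.mpr fun k _ => sub_ne_zero.mpr (h k).symm

theorem one_sub_pow_succ_ne_zero {q : ℂ} (hq : ‖q‖ < 1) (n : ℕ) : 1 - q ^ (n + 1) ≠ 0 := by
  intro h
  have h1 : ‖q ^ (n + 1)‖ < 1 := by
    rw [norm_pow]
    exact pow_lt_one₀ (norm_nonneg _) hq (Nat.succ_ne_zero n)
  rw [← sub_eq_zero.mp h, norm_one] at h1
  exact lt_irrefl _ h1

theorem mul_pow_ne_one {a q : ℂ} (ha : ‖a‖ < 1) (hq : ‖q‖ < 1) (k : ℕ) : a * q ^ k ≠ 1 := by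
  intro h
  have h1 : ‖a * q ^ k‖ < 1 := by
    rw [norm_mul, norm_pow]
    exact mul_lt_one_of_nonneg_of_lt_one_left (norm_nonneg _) ha
      (pow_le_one₀ (norm_nonneg _) hq.le)
  rw [h, norm_one] at h1
  exact lt_irrefl _ h1

theorem qPoch_self_ne_zero {q : ℂ} (hq : ‖q‖ < 1) (n : ℕ) : qPoch q q n ≠ 0 :=
  qPoch_ne_zero (mul_pow_ne_one hq hq) n

theorem qPoch_inv_pow_eq_zero {q : ℂ} (hq0 : q ≠ 0) {n k : ℕ} (h : n < k) :
    qPoch (q ^ n)⁻¹ q k = 0 := by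
  refine Finset.prod_eq_zero (Finset.mem_range.mpr h) ?_
  rw [inv_mul_cancel₀ (pow_ne_zero _ hq0), sub_self]

/-! ### Divided differences on the geometric nodes. -/

/-- Divided differences of a sequence, regarded as a function on the nodes `q ^ k`:
`divDiff q h N s` is the divided difference at `q ^ s, …, q ^ (s + N)`. -/
noncomputable def divDiff (q : ℂ) (h : ℕ → ℂ) : ℕ → ℕ → ℂ
  | 0, s => h s
  | N + 1, s => (divDiff q h N s - divDiff q h N (s + 1)) / (q ^ s * (1 - q ^ (N + 1)))

theorem divDiff_succ_mul {q : ℂ} (hq0 : q ≠ 0) (hq : ‖q‖ < 1) (h : ℕ → ℂ) (N s : ℕ) :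
    (q ^ s - q ^ (s + N + 1)) * divDiff q h (N + 1) s
      = divDiff q h N s - divDiff q h N (s + 1) := by
  have h1 := one_sub_pow_succ_ne_zero hq N
  have h2 := pow_ne_zero s hq0
  have h3 : q ^ s - q ^ (s + N + 1) = q ^ s * (1 - q ^ (N + 1)) := by ring
  rw [divDiff, h3, mul_div_cancel₀ _ (mul_ne_zero h2 h1)]

/-- Leibniz rule. The node difference is split at the intermediate node `q ^ (s + p.1)`; each half
lowers the order of one factor, and the two resulting sums recombine by telescoping. -/
theorem divDiff_mul {q : ℂ} (hq0 : q ≠ 0) (hq : ‖q‖ < 1) (f g : ℕ → ℂ) (N s : ℕ) :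
    divDiff q (fun k => f k * g k) N s =
      ∑ p ∈ Finset.HasAntidiagonal.antidiagonal N, divDiff q f p.1 s * divDiff q g p.2 (s + p.1) := by
  induction N generalizing s with
  | zero => simp [divDiff]
  | succ N ih =>
    have hne : q ^ s - q ^ (s + N + 1) ≠ 0 := by
      have h3 : q ^ s - q ^ (s + N + 1) = q ^ s * (1 - q ^ (N + 1)) := by ring
      rw [h3]
      exact mul_ne_zero (pow_ne_zero s hq0) (one_sub_pow_succ_ne_zero hq N)
    apply mul_left_cancel₀ hne
    rw [divDiff_succ_mul hq0 hq, ih, ih, Finset.mul_sum]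
    have key : ∀ p ∈ Finset.HasAntidiagonal.antidiagonal (N + 1),
        (q ^ s - q ^ (s + N + 1)) * (divDiff q f p.1 s * divDiff q g p.2 (s + p.1)) =
          (q ^ s - q ^ (s + p.1)) * divDiff q f p.1 s * divDiff q g p.2 (s + p.1) +
          divDiff q f p.1 s *
            ((q ^ (s + p.1) - q ^ (s + p.1 + p.2)) * divDiff q g p.2 (s + p.1)) := by
      intro p hp
      rw [add_assoc s p.1 p.2, Finset.HasAntidiagonal.mem_antidiagonal.mp hp]
      ring
    rw [Finset.sum_congr rfl key, Finset.sum_add_distrib, Finset.Nat.sum_antidiagonal_succ,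
      Finset.Nat.sum_antidiagonal_succ', ← Finset.sum_sub_distrib]
    simp only [add_zero, sub_self, zero_mul, mul_zero, zero_add]
    rw [← Finset.sum_add_distrib]
    refine Finset.sum_congr rfl fun p _ => ?_
    rw [← add_assoc s p.1 1, divDiff_succ_mul hq0 hq, ← add_assoc (s + p.1) p.2 1,
      divDiff_succ_mul hq0 hq, add_right_comm s 1 p.1]
    ring

theorem divDiff_qPoch {q : ℂ} (hq0 : q ≠ 0) (hq : ‖q‖ < 1) (A : ℂ) (N s : ℕ) :
    divDiff q (qPoch A q) N s = qPoch A q s * A ^ N / qPoch q q N := by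
  induction N generalizing s with
  | zero => simp [divDiff, qPoch]
  | succ N ih =>
    have h1 := one_sub_pow_succ_ne_zero hq N
    have h2 := pow_ne_zero s hq0
    have h3 := qPoch_self_ne_zero hq N
    rw [divDiff, ih, ih, qPoch_succ A, qPoch_succ q, ← pow_succ' q N]
    field_simp
    ring

/-- The quadratic power of `q` is the point: denominator parameters give superexponential decay and
do not influence the growth rate. -/
theorem divDiff_inv_qPoch {q : ℂ} (hq0 : q ≠ 0) (hq : ‖q‖ < 1) {B : ℂ} (hB : ‖B‖ < 1) (N s : ℕ) :
    divDiff q (fun k => (qPoch B q k)⁻¹) N s =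
      (-B) ^ N * q ^ (N * (N - 1) / 2) / (qPoch B q (s + N) * qPoch q q N) := by
  induction N generalizing s with
  | zero => simp [divDiff, qPoch]
  | succ N ih =>
    have h1 := one_sub_pow_succ_ne_zero hq N
    have h2 := pow_ne_zero s hq0
    have h3 := qPoch_self_ne_zero hq N
    have h4 := qPoch_ne_zero (mul_pow_ne_one hB hq) (s + N)
    have h5 : 1 - B * q ^ (s + N) ≠ 0 := sub_ne_zero.mpr (mul_pow_ne_one hB hq _).symm
    have h6 : (N + 1) * (N + 1 - 1) / 2 = N * (N - 1) / 2 + N := by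
      rw [← Finset.sum_range_id_mul_two, ← Finset.sum_range_id_mul_two,
        Nat.mul_div_cancel _ two_pos, Nat.mul_div_cancel _ two_pos, Finset.sum_range_succ]
    have h7 := qPoch_ne_zero (mul_pow_ne_one hB hq) (s + N + 1)
    have e : (qPoch B q (s + N))⁻¹ = (1 - B * q ^ (s + N)) * (qPoch B q (s + N + 1))⁻¹ := by
      rw [qPoch_succ]
      field_simp
    rw [divDiff, ih, ih, h6, qPoch_succ q, ← pow_succ' q N, add_right_comm s 1 N, ← add_assoc s N 1,
      pow_add q _ N, div_mul_eq_div_div _ (qPoch B q (s + N)), div_eq_mul_inv _ (qPoch B q (s + N)), e]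
    generalize qPoch B q (s + N + 1) = D at *
    field_simp
    ring

theorem divDiff_pow_one {q : ℂ} (hq0 : q ≠ 0) (hq : ‖q‖ < 1) (s : ℕ) :
    divDiff q (fun k => q ^ k) 1 s = 1 := by
  have h1 := one_sub_pow_succ_ne_zero hq 0
  have h2 := pow_ne_zero s hq0
  rw [divDiff]
  simp only [divDiff]
  rw [div_eq_one_iff_eq (mul_ne_zero h2 h1)]
  ring

theorem divDiff_pow_add_two {q : ℂ} (hq0 : q ≠ 0) (hq : ‖q‖ < 1) (N s : ℕ) :
    divDiff q (fun k => q ^ k) (N + 2) s = 0 := by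
  induction N generalizing s with
  | zero => rw [divDiff, divDiff_pow_one hq0 hq, divDiff_pow_one hq0 hq]; simp
  | succ N ih => rw [divDiff, ih, ih]; simp

theorem divDiff_const_succ (q c : ℂ) (N s : ℕ) : divDiff q (fun _ => c) (N + 1) s = 0 := by
  induction N generalizing s with
  | zero => simp [divDiff]
  | succ N ih => rw [divDiff, ih, ih]; simp

theorem qPoch_inv_pow_succ {q : ℂ} (hq0 : q ≠ 0) (N k : ℕ) :
    qPoch (q ^ (N + 1))⁻¹ q (k + 1) = (1 - (q ^ (N + 1))⁻¹) * qPoch (q ^ N)⁻¹ q k := by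
  rw [qPoch_succ', show (q ^ (N + 1))⁻¹ * q = (q ^ N)⁻¹ by rw [pow_succ]; field_simp]

/-- The explicit form of the divided differences at the nodes `q ^ k`. -/
theorem sum_eq_divDiff {q : ℂ} (hq0 : q ≠ 0) (hq : ‖q‖ < 1) (h : ℕ → ℂ) (N s : ℕ) :
    ∑ k ∈ Finset.range (N + 1), qPoch (q ^ N)⁻¹ q k * q ^ k / qPoch q q k * h (s + k)
      = q ^ (s * N) * qPoch q q N * divDiff q h N s := by
  induction N generalizing s with
  | zero => simp [divDiff, qPoch]
  | succ N ih =>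
    have h1 := one_sub_pow_succ_ne_zero hq N
    have h2 := pow_ne_zero s hq0
    have h3 := pow_ne_zero N hq0
    -- The defining recursion cleared of denominators, to be matched with a Pascal-type recurrence
    -- for the coefficients.
    have hR : q ^ (s * (N + 1)) * qPoch q q (N + 1) * divDiff q h (N + 1) s =
        q ^ (s * N) * qPoch q q N * divDiff q h N s
          - (q ^ N)⁻¹ * (q ^ ((s + 1) * N) * qPoch q q N * divDiff q h N (s + 1)) := by
      rw [divDiff, qPoch_succ, ← pow_succ' q N]
      have e1 : q ^ (s * (N + 1)) = q ^ (s * N) * q ^ s := by ring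
      have e2 : q ^ ((s + 1) * N) = q ^ (s * N) * q ^ N := by ring
      rw [e1, e2]
      field_simp
    -- The added term `k = N + 1` is zero because `(q ^ (-N); q)_(N+1) = 0`.
    have hext : ∑ k ∈ Finset.range (N + 1), qPoch (q ^ N)⁻¹ q k * q ^ k / qPoch q q k * h (s + k) =
        ∑ k ∈ Finset.range (N + 2),
          qPoch (q ^ N)⁻¹ q k * q ^ k / qPoch q q k * h (s + k) := by
      rw [Finset.sum_range_succ _ (N + 1), qPoch_inv_pow_eq_zero hq0 (Nat.lt_succ_self N)]
      simp
    rw [hR, ← ih, ← ih, hext, Finset.sum_range_succ', Finset.sum_range_succ' _ (N + 1),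
      Finset.mul_sum, add_sub_right_comm, ← Finset.sum_sub_distrib]
    congr 1
    · refine Finset.sum_congr rfl fun k _ => ?_
      have h4 := one_sub_pow_succ_ne_zero hq k
      have h5 := qPoch_self_ne_zero hq k
      rw [qPoch_inv_pow_succ hq0, qPoch_succ _ _ k, qPoch_succ _ _ k, ← pow_succ' q k,
        add_assoc s 1 k, add_comm 1 k]
      field_simp
      ring

/-! ### The inversion formula. -/

theorem wellPoised_succ_mul (α q : ℂ) (n k : ℕ) :
    wellPoised α q (n + 1) * qPoch (α * q ^ (n + 1)) q k =
      (1 - α * q ^ (2 * (n + 1))) * qPoch (α * q) q (n + k) / qPoch q q (n + 1) := by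
  rw [wellPoised, if_neg (Nat.succ_ne_zero n), Nat.add_sub_cancel, qPoch_add (α * q),
    show α * q ^ (n + 1) = α * q * q ^ n by ring]
  ring

theorem wellPoised_mul_self (α q : ℂ) (n : ℕ) :
    wellPoised α q n * qPoch (α * q ^ n) q n =
      qPoch (α * q) q n * qPoch (α * q ^ (n + 1)) q n / qPoch q q n := by
  cases n with
  | zero => simp [wellPoised, qPoch]
  | succ n =>
    rw [wellPoised_succ_mul, show α * q ^ (n + 1 + 1) = α * q * q ^ (n + 1) by ring, ← qPoch_add,
      show n + 1 + (n + 1) = n + (n + 1) + 1 by ring, qPoch_succ _ _ (n + (n + 1))]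
    ring

/-- Reversing the product gives `(q ^ (-N); q)_N = (-1) ^ N q ^ (-N(N+1)/2) (q; q)_N`; squaring
removes the sign and the halved exponent. -/
theorem qPoch_inv_pow_sq {q : ℂ} (hq0 : q ≠ 0) (N : ℕ) :
    qPoch (q ^ N)⁻¹ q N ^ 2 * q ^ (N * (N + 1)) = qPoch q q N ^ 2 := by
  induction N with
  | zero => simp [qPoch]
  | succ N ih =>
    have h3 := pow_ne_zero (N + 1) hq0
    rw [qPoch_inv_pow_succ hq0, qPoch_succ, mul_pow, mul_pow, ← ih, ← pow_succ' q N,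
      show q ^ ((N + 1) * (N + 1 + 1)) = q ^ (N * (N + 1)) * q ^ (N + 1) * q ^ (N + 1) by ring]
    field_simp
    ring

/-- Closed form of the partial sums, which gives orthogonality: at `M = N` the right side contains
`(q ^ (-N); q)_(N+1) = 0`, so the sum vanishes for `k < N`. At `k = N` the prefactor is zero and
nothing is learned. -/
theorem sum_wellPoised_telescope {α q : ℂ} (hq0 : q ≠ 0) (hq : ‖q‖ < 1) {N : ℕ}
    (hα : ∀ i, α * q ^ (N + 1) * q ^ i ≠ 1) (k M : ℕ) :
    (1 - q ^ k * (q ^ N)⁻¹) * ∑ n ∈ Finset.range (M + 1),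
      wellPoised α q n * qPoch (q ^ N)⁻¹ q n * (q ^ N) ^ n / qPoch (α * q ^ (N + 1)) q n *
        (qPoch (q ^ n)⁻¹ q k * qPoch (α * q ^ n) q k) =
    qPoch (α * q) q (M + k) * qPoch (q ^ N)⁻¹ q (M + 1) * (q ^ N) ^ M * qPoch (q ^ M)⁻¹ q k /
      (qPoch q q M * qPoch (α * q ^ (N + 1)) q M) := by
  have h0 := pow_ne_zero N hq0
  induction M with
  | zero =>
    cases k with
    | zero => simp [wellPoised, qPoch]
    | succ k => simp [qPoch_succ' 1 q k]
  | succ M ih =>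
    have h1 := one_sub_pow_succ_ne_zero hq M
    have h3 := qPoch_self_ne_zero hq M
    have h4 := qPoch_ne_zero hα M
    have h5 : 1 - α * q ^ (N + 1) * q ^ M ≠ 0 := sub_ne_zero.mpr (hα M).symm
    have h6 := pow_ne_zero (M + 1) hq0
    have h7 : 1 - (q ^ (M + 1))⁻¹ ≠ 0 := by
      intro h
      apply h1
      rw [sub_eq_zero, eq_comm, inv_eq_one] at h
      rw [h, sub_self]
    -- Rewritten with base `q ^ (-(M + 1))`, so that the old partial sum and the new term share this
    -- factor.
    have h8 : qPoch (q ^ M)⁻¹ q k = qPoch (q ^ (M + 1))⁻¹ q k *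
        (1 - (q ^ (M + 1))⁻¹ * q ^ k) / (1 - (q ^ (M + 1))⁻¹) := by
      rw [eq_div_iff h7, ← qPoch_succ, qPoch_inv_pow_succ hq0, mul_comm]
    have h9 : wellPoised α q (M + 1) * qPoch (q ^ N)⁻¹ q (M + 1) * (q ^ N) ^ (M + 1) /
        qPoch (α * q ^ (N + 1)) q (M + 1) *
        (qPoch (q ^ (M + 1))⁻¹ q k * qPoch (α * q ^ (M + 1)) q k) =
        (1 - α * q ^ (2 * (M + 1))) * qPoch (α * q) q (M + k) / qPoch q q (M + 1) *
        qPoch (q ^ N)⁻¹ q (M + 1) * (q ^ N) ^ (M + 1) /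
        qPoch (α * q ^ (N + 1)) q (M + 1) * qPoch (q ^ (M + 1))⁻¹ q k := by
      rw [← wellPoised_succ_mul]
      ring
    rw [Finset.sum_range_succ, mul_add, ih, h8, h9, qPoch_succ (q ^ N)⁻¹ q (M + 1),
      show M + 1 + k = M + k + 1 by ring, qPoch_succ (α * q) q (M + k), qPoch_succ q q M,
      qPoch_succ (α * q ^ (N + 1)) q M, ← pow_succ' q M]
    generalize qPoch (q ^ (M + 1))⁻¹ q k = X1
    generalize qPoch (q ^ N)⁻¹ q (M + 1) = X2
    generalize qPoch (α * q) q (M + k) = X3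
    generalize qPoch q q M = X4 at *
    generalize qPoch (α * q ^ (N + 1)) q M = X5 at *
    have h10 : (1 - (q ^ (M + 1))⁻¹ * q ^ k) / (1 - (q ^ (M + 1))⁻¹) =
        (q ^ k - q ^ (M + 1)) / (1 - q ^ (M + 1)) := by
      rw [div_eq_div_iff h7 h1]
      field_simp
      ring
    rw [mul_div_assoc X1, h10]
    have e1 : α * q ^ (N + 1) * q ^ M = α * q ^ N * q ^ (M + 1) := by ring
    have e2 : α * q * q ^ (M + k) = α * q ^ (M + 1) * q ^ k := by ring
    have e3 : q ^ (2 * (M + 1)) = q ^ (M + 1) * q ^ (M + 1) := by ring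
    rw [e1] at h5 ⊢
    rw [e2, e3, pow_succ (q ^ N) M]
    generalize q ^ (M + 1) = y at *
    generalize (q ^ N) ^ M = Z
    generalize q ^ N = u at *
    obtain ⟨D, hD⟩ : ∃ D, D = 1 - α * u * y := ⟨_, rfl⟩
    rw [← hD] at h5 ⊢
    field_simp
    rw [hD]
    ring

theorem bailey_inversion {α q : ℂ} (hq0 : q ≠ 0) (hq : ‖q‖ < 1) {N : ℕ}
    (hα : ∀ i, α * q ^ (N + 1) * q ^ i ≠ 1) (g : ℕ → ℂ) :
    ∑ n ∈ Finset.range (N + 1),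
      wellPoised α q n * qPoch (q ^ N)⁻¹ q n * (q ^ N) ^ n / qPoch (α * q ^ (N + 1)) q n *
        ∑ k ∈ Finset.range (n + 1),
          qPoch (q ^ n)⁻¹ q k * q ^ k / qPoch q q k * (qPoch (α * q ^ n) q k * g k) =
      qPoch (α * q) q N * g N := by
  have hext : ∀ n ∈ Finset.range (N + 1),
      wellPoised α q n * qPoch (q ^ N)⁻¹ q n * (q ^ N) ^ n / qPoch (α * q ^ (N + 1)) q n *
        ∑ k ∈ Finset.range (n + 1),
          qPoch (q ^ n)⁻¹ q k * q ^ k / qPoch q q k * (qPoch (α * q ^ n) q k * g k) =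
      ∑ k ∈ Finset.range (N + 1), q ^ k / qPoch q q k * g k *
        (wellPoised α q n * qPoch (q ^ N)⁻¹ q n * (q ^ N) ^ n / qPoch (α * q ^ (N + 1)) q n *
        (qPoch (q ^ n)⁻¹ q k * qPoch (α * q ^ n) q k)) := by
    intro n hn
    rw [Finset.mem_range] at hn
    rw [Finset.sum_subset (Finset.range_subset_range.mpr (Nat.succ_le_of_lt hn)), Finset.mul_sum]
    · exact Finset.sum_congr rfl fun k _ => by ring
    · intro k _ hk
      rw [Finset.mem_range, not_lt] at hk
      rw [qPoch_inv_pow_eq_zero hq0 hk]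
      simp
  rw [Finset.sum_congr rfl hext, Finset.sum_comm]
  simp_rw [← Finset.mul_sum]
  -- Orthogonality leaves only `k = N`; there `(q ^ (-n); q)_N = 0` for `n < N` leaves only `n = N`.
  rw [Finset.sum_range_succ, Finset.sum_eq_zero, zero_add, Finset.sum_range_succ,
    Finset.sum_eq_zero, zero_add]
  · have h1 := wellPoised_mul_self α q N
    have h2 := qPoch_inv_pow_sq hq0 N
    have h3 := qPoch_self_ne_zero hq N
    have h4 := qPoch_ne_zero hα N
    calc _ = qPoch (q ^ N)⁻¹ q N ^ 2 * q ^ (N * (N + 1)) *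
          (wellPoised α q N * qPoch (α * q ^ N) q N) / qPoch (α * q ^ (N + 1)) q N /
          qPoch q q N * g N := by ring
      _ = _ := by
        rw [h1, h2]
        field_simp
  · intro n hn
    rw [qPoch_inv_pow_eq_zero hq0 (Finset.mem_range.mp hn)]
    simp
  · intro k hk
    rw [Finset.mem_range] at hk
    have h1 := sum_wellPoised_telescope hq0 hq hα k N
    rw [qPoch_inv_pow_eq_zero (n := N) (k := N + 1) hq0 (Nat.lt_succ_self N)] at h1
    simp only [mul_zero, zero_mul, zero_div] at h1
    have h2 : 1 - q ^ k * (q ^ N)⁻¹ ≠ 0 := by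
      obtain ⟨d, rfl⟩ := Nat.exists_eq_add_of_lt hk
      have h3 := one_sub_pow_succ_ne_zero hq d
      have h5 := pow_ne_zero k hq0
      rw [add_assoc, pow_add, mul_inv, mul_inv_cancel_left₀ h5]
      intro h
      apply h3
      rw [sub_eq_zero, eq_comm, inv_eq_one] at h
      rw [h, sub_self]
    rw [(mul_eq_zero.mp h1).resolve_left h2, mul_zero]

/-! ### Infinite products and boundedness of the finite ones. -/

theorem tendsto_qPoch (a : ℂ) {q : ℂ} (hq : ‖q‖ < 1) :
    Tendsto (qPoch a q) atTop (𝓝 (qPochInf a q)) :=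
  (qPochInf_hasProd a q hq).tendsto_prod_nat

theorem exists_norm_le_of_tendsto {f : ℕ → ℂ} {x : ℂ} (h : Tendsto f atTop (𝓝 x)) :
    ∃ C, 0 ≤ C ∧ ∀ n, ‖f n‖ ≤ C := by
  obtain ⟨C, hC⟩ := (Metric.isBounded_range_of_tendsto f h).exists_norm_le
  exact ⟨C, (norm_nonneg _).trans (hC (f 0) ⟨0, rfl⟩), fun n => hC _ ⟨n, rfl⟩⟩

theorem exists_norm_qPoch_le (a : ℂ) {q : ℂ} (hq : ‖q‖ < 1) :
    ∃ C, 0 ≤ C ∧ ∀ n, ‖qPoch a q n‖ ≤ C :=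
  exists_norm_le_of_tendsto (tendsto_qPoch a hq)

theorem summable_norm_mul_pow (a : ℂ) {q : ℂ} (hq : ‖q‖ < 1) :
    Summable fun k : ℕ => ‖-(a * q ^ k)‖ := by
  simp only [norm_neg, norm_mul, norm_pow]
  exact (summable_geometric_of_lt_one (norm_nonneg q) hq).mul_left _

theorem qPochInf_ne_zero {a q : ℂ} (hq : ‖q‖ < 1) (h : ∀ k, a * q ^ k ≠ 1) :
    qPochInf a q ≠ 0 := by
  have := tprod_one_add_ne_zero_of_summable (f := fun k : ℕ => -(a * q ^ k))
    (fun k => by rw [← sub_eq_add_neg]; exact sub_ne_zero.mpr (h k).symm)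
    (summable_norm_mul_pow a hq)
  simpa only [qPochInf, ← sub_eq_add_neg] using this

theorem exists_norm_inv_qPoch_le {a q : ℂ} (hq : ‖q‖ < 1) (h : ∀ k, a * q ^ k ≠ 1) :
    ∃ C, 0 ≤ C ∧ ∀ n, ‖(qPoch a q n)⁻¹‖ ≤ C :=
  exists_norm_le_of_tendsto ((tendsto_qPoch a hq).inv₀ (qPochInf_ne_zero hq h))

theorem summable_pow_mul_pow_choose {x r : ℝ} (hx : 0 ≤ x) (hr0 : 0 < r) (hr : r < 1) :
    Summable fun n : ℕ => x ^ n * r ^ (n * (n - 1) / 2) := by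
  rcases hx.eq_or_lt with rfl | hx
  · refine summable_of_ne_finset_zero (s := {0}) fun n hn => ?_
    rw [zero_pow (by simpa using hn), zero_mul]
  refine summable_of_ratio_test_tendsto_lt_one (l := 0) zero_lt_one
    (Eventually.of_forall fun n => by positivity) ?_
  have h : Tendsto (fun n : ℕ => x * r ^ n) atTop (𝓝 0) := by
    simpa using (tendsto_pow_atTop_nhds_zero_of_lt_one hr0.le hr).const_mul x
  refine h.congr fun n => ?_
  have h6 : (n + 1) * (n + 1 - 1) / 2 = n * (n - 1) / 2 + n := by
    rw [← Finset.sum_range_id_mul_two, ← Finset.sum_range_id_mul_two,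
      Nat.mul_div_cancel _ two_pos, Nat.mul_div_cancel _ two_pos, Finset.sum_range_succ]
  rw [h6, Real.norm_of_nonneg (by positivity), Real.norm_of_nonneg (by positivity)]
  field_simp
  ring

/-! ### Growth of divided differences. -/

/-- The divided differences of `h` are of order at most `σ ^ N` for each `σ > ρ`, uniformly in the
first node. -/
def DivDiffBound (q : ℂ) (ρ : ℝ) (h : ℕ → ℂ) : Prop :=
  ∀ σ > ρ, ∃ C, 0 ≤ C ∧ ∀ N s, ‖divDiff q h N s‖ ≤ C * σ ^ N

/-- The `N + 1` Leibniz terms cost a factor `N + 1`, absorbed by passing from `τ` to a larger `σ`.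
This is why the bound is required for all `σ > ρ` and not at `ρ` itself. -/
theorem divDiffBound_mul {q : ℂ} {ρ : ℝ} (hq0 : q ≠ 0) (hq : ‖q‖ < 1) (hρ : 0 ≤ ρ)
    {f g : ℕ → ℂ} (hf : DivDiffBound q ρ f) (hg : DivDiffBound q ρ g) :
    DivDiffBound q ρ (fun k => f k * g k) := by
  intro σ hσ
  obtain ⟨τ, h1, h2⟩ := exists_between hσ
  obtain ⟨C, hC, hf⟩ := hf τ h1
  obtain ⟨D, hD, hg⟩ := hg τ h1
  have hτ : 0 < τ := hρ.trans_lt h1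
  have hσ0 : 0 < σ := hτ.trans h2
  have hr : τ / σ < 1 := (div_lt_one hσ0).mpr h2
  obtain ⟨K, hK⟩ := (Metric.isBounded_range_of_tendsto _
    (tendsto_self_mul_const_pow_of_lt_one (by positivity) hr)).exists_norm_le
  have hK0 : 0 ≤ K := (norm_nonneg _).trans (hK _ ⟨0, rfl⟩)
  refine ⟨C * D * (K + 1), by positivity, fun N s => ?_⟩
  rw [divDiff_mul hq0 hq]
  have hb : ∀ p ∈ Finset.HasAntidiagonal.antidiagonal N,
      ‖divDiff q f p.1 s * divDiff q g p.2 (s + p.1)‖ ≤ C * D * τ ^ N := by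
    intro p hp
    rw [norm_mul, ← Finset.HasAntidiagonal.mem_antidiagonal.mp hp, pow_add]
    calc _ ≤ (C * τ ^ p.1) * (D * τ ^ p.2) :=
          mul_le_mul (hf _ _) (hg _ _) (norm_nonneg _) (by positivity)
      _ = _ := by ring
  refine (norm_sum_le_of_le _ hb).trans ?_
  rw [Finset.sum_const, Finset.Nat.card_antidiagonal, nsmul_eq_mul]
  have e : τ ^ N = (τ / σ) ^ N * σ ^ N := by
    rw [← mul_pow, div_mul_cancel₀ _ hσ0.ne']
  have h3 : (N : ℝ) * (τ / σ) ^ N ≤ K := (le_abs_self _).trans (hK _ ⟨N, rfl⟩)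
  have h4 : (τ / σ) ^ N ≤ 1 := pow_le_one₀ (by positivity) hr.le
  calc _ = C * D * ((N : ℝ) * (τ / σ) ^ N + (τ / σ) ^ N) * σ ^ N := by
        rw [e]
        push_cast
        ring
    _ ≤ _ := by gcongr

theorem divDiffBound_const (q c : ℂ) {ρ : ℝ} (hρ : 0 ≤ ρ) : DivDiffBound q ρ (fun _ => c) := by
  intro σ hσ
  have hσ0 : 0 < σ := hρ.trans_lt hσ
  refine ⟨‖c‖, norm_nonneg _, fun N s => ?_⟩
  cases N with
  | zero => simp [divDiff]
  | succ N =>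
    rw [divDiff_const_succ, norm_zero]
    positivity

theorem divDiffBound_prod {ι : Type*} {q : ℂ} {ρ : ℝ} (hq0 : q ≠ 0) (hq : ‖q‖ < 1) (hρ : 0 ≤ ρ)
    (t : Finset ι) {f : ι → ℕ → ℂ} (hf : ∀ i ∈ t, DivDiffBound q ρ (f i)) :
    DivDiffBound q ρ (fun k => ∏ i ∈ t, f i k) := by
  classical
  induction t using Finset.induction_on with
  | empty => simpa using divDiffBound_const q 1 hρ
  | insert i t hi ih =>
    simp only [Finset.prod_insert hi]
    exact divDiffBound_mul hq0 hq hρ (hf i (Finset.mem_insert_self _ _))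
      (ih fun j hj => hf j (Finset.mem_insert_of_mem hj))

theorem divDiffBound_pow {q : ℂ} {ρ : ℝ} (hq0 : q ≠ 0) (hq : ‖q‖ < 1) (hρ : 0 ≤ ρ) :
    DivDiffBound q ρ (fun k => q ^ k) := by
  intro σ hσ
  have hσ0 : 0 < σ := hρ.trans_lt hσ
  -- On the nodes this is the identity function: `1` covers order 0, `σ⁻¹` covers order 1, and
  -- higher orders vanish.
  refine ⟨1 + σ⁻¹, by positivity, fun N s => ?_⟩
  match N with
  | 0 =>
    have : ‖q‖ ^ s ≤ 1 := pow_le_one₀ (norm_nonneg _) hq.le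
    have : 0 < σ⁻¹ := by positivity
    simp only [divDiff, norm_pow, pow_zero]
    linarith
  | 1 =>
    rw [divDiff_pow_one hq0 hq, norm_one, pow_one, add_mul, inv_mul_cancel₀ hσ0.ne']
    linarith
  | N + 2 =>
    rw [divDiff_pow_add_two hq0 hq, norm_zero]
    positivity

theorem divDiffBound_qPoch {q : ℂ} {ρ : ℝ} (hq0 : q ≠ 0) (hq : ‖q‖ < 1) {A : ℂ} (hA : ‖A‖ ≤ ρ) :
    DivDiffBound q ρ (qPoch A q) := by
  intro σ hσ
  obtain ⟨C, hC, h1⟩ := exists_norm_qPoch_le A hq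
  obtain ⟨D, hD, h2⟩ := exists_norm_inv_qPoch_le hq (mul_pow_ne_one hq hq)
  refine ⟨C * D, by positivity, fun N s => ?_⟩
  rw [divDiff_qPoch hq0 hq, div_eq_mul_inv, norm_mul, norm_mul, norm_pow]
  have h3 : ‖A‖ ^ N ≤ σ ^ N := pow_le_pow_left₀ (norm_nonneg _) (hA.trans hσ.le) N
  calc _ ≤ C * σ ^ N * D := by
        refine mul_le_mul (mul_le_mul (h1 s) h3 (by positivity) hC) (h2 N) (norm_nonneg _) ?_
        exact mul_nonneg hC (le_trans (by positivity) h3)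
    _ = _ := by ring

theorem divDiffBound_inv_qPoch {q : ℂ} {ρ : ℝ} (hq0 : q ≠ 0) (hq : ‖q‖ < 1) (hρ : 0 ≤ ρ)
    {B : ℂ} (hB : ‖B‖ < 1) : DivDiffBound q ρ (fun k => (qPoch B q k)⁻¹) := by
  intro σ hσ
  have hσ0 : 0 < σ := hρ.trans_lt hσ
  obtain ⟨C, hC, h1⟩ := exists_norm_inv_qPoch_le hq (mul_pow_ne_one hB hq)
  obtain ⟨D, hD, h2⟩ := exists_norm_inv_qPoch_le hq (mul_pow_ne_one hq hq)
  have hs := summable_pow_mul_pow_choose (x := ‖B‖ / σ) (by positivity) (norm_pos_iff.mpr hq0) hq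
  -- A single term is bounded by the whole convergent series.
  refine ⟨(∑' n : ℕ, (‖B‖ / σ) ^ n * ‖q‖ ^ (n * (n - 1) / 2)) * C * D, ?_, fun N s => ?_⟩
  · have : 0 ≤ ∑' n : ℕ, (‖B‖ / σ) ^ n * ‖q‖ ^ (n * (n - 1) / 2) := tsum_nonneg fun n : ℕ =>
      (by positivity : 0 ≤ (‖B‖ / σ) ^ n * ‖q‖ ^ (n * (n - 1) / 2))
    positivity
  have h3 := hs.le_tsum N fun n _ => by positivity
  rw [divDiff_inv_qPoch hq0 hq hB, div_eq_mul_inv, mul_inv, norm_mul, norm_mul, norm_mul, norm_pow,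
    norm_pow, norm_neg]
  have e : ‖B‖ ^ N = (‖B‖ / σ) ^ N * σ ^ N := by
    rw [← mul_pow, div_mul_cancel₀ _ hσ0.ne']
  calc _ = ((‖B‖ / σ) ^ N * ‖q‖ ^ (N * (N - 1) / 2)) * ‖(qPoch B q (s + N))⁻¹‖ *
        ‖(qPoch q q N)⁻¹‖ * σ ^ N := by
        rw [e]
        ring
    _ ≤ _ := by
        have h4 := h1 (s + N)
        have h5 := h2 N
        gcongr

/-- The sequence to which the inversion is applied. -/
noncomputable def hypSeq {m : ℕ} (q α b : ℂ) (bs cs : Fin m → ℂ) (l k : ℕ) : ℂ :=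
  (∏ _i ∈ Finset.range l, q ^ k) * (qPoch (α * b) q k)⁻¹ *
    ((∏ j, qPoch (α * cs j) q k) * ∏ j, (qPoch (α * bs j) q k)⁻¹)

theorem divDiffBound_hypSeq {m : ℕ} {q α b : ℂ} {bs cs : Fin m → ℂ} {ρ : ℝ} (hq0 : q ≠ 0)
    (hq : ‖q‖ < 1) (hρ : 0 ≤ ρ) (hb : ‖α * b‖ < 1) (hbs : ∀ j, ‖α * bs j‖ < 1)
    (hcs : ∀ j, ‖α * cs j‖ ≤ ρ) (l : ℕ) : DivDiffBound q ρ (hypSeq q α b bs cs l) := by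
  -- The factor `q ^ (k * l)` is treated as `l` copies of the identity function on the nodes.
  have h1 := divDiffBound_prod hq0 hq hρ (Finset.range l) (f := fun _ k => q ^ k)
    fun _ _ => divDiffBound_pow hq0 hq hρ
  have h2 := divDiffBound_inv_qPoch hq0 hq hρ hb
  have h3 := divDiffBound_prod hq0 hq hρ Finset.univ (f := fun j => qPoch (α * cs j) q)
    fun j _ => divDiffBound_qPoch hq0 hq (hcs j)
  have h4 := divDiffBound_prod hq0 hq hρ Finset.univ (f := fun j k => (qPoch (α * bs j) q k)⁻¹)
    fun j _ => divDiffBound_inv_qPoch hq0 hq hρ (hbs j)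
  exact divDiffBound_mul hq0 hq hρ (divDiffBound_mul hq0 hq hρ h1 h2)
    (divDiffBound_mul hq0 hq hρ h3 h4)

/-- The factor `(α q ^ n; q)_k` varies with `n`, but its divided difference of order `p` carries `(α
q ^ n) ^ p`. As `p ≤ n`, the power `|q| ^ (n p)` is at most `|q| ^ (p(p-1)/2)`, so the Leibniz sum
converges uniformly in `n` and `α` does not affect the rate. -/
theorem exists_norm_sum_le {q α : ℂ} {ρ σ : ℝ} (hq0 : q ≠ 0) (hq : ‖q‖ < 1) (hρ : 0 ≤ ρ)
    (hσ : ρ < σ) {g : ℕ → ℂ} (hg : DivDiffBound q ρ g) :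
    ∃ C, 0 ≤ C ∧ ∀ n : ℕ, ‖∑ k ∈ Finset.range (n + 1),
      qPoch (q ^ n)⁻¹ q k * q ^ k / qPoch q q k * (qPoch (α * q ^ n) q k * g k)‖ ≤ C * σ ^ n := by
  have hσ0 : 0 < σ := hρ.trans_lt hσ
  have hqn := norm_pos_iff.mpr hq0
  obtain ⟨C, hC, h1⟩ := hg σ hσ
  obtain ⟨D, hD, h2⟩ := exists_norm_inv_qPoch_le hq (mul_pow_ne_one hq hq)
  obtain ⟨K, hK, h3⟩ := exists_norm_qPoch_le q hq
  have hs := summable_pow_mul_pow_choose (x := ‖α‖ / σ) (by positivity) hqn hq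
  have hT : 0 ≤ ∑' n : ℕ, (‖α‖ / σ) ^ n * ‖q‖ ^ (n * (n - 1) / 2) := tsum_nonneg fun n : ℕ =>
      (by positivity : 0 ≤ (‖α‖ / σ) ^ n * ‖q‖ ^ (n * (n - 1) / 2))
  refine ⟨K * (C * D * ∑' n : ℕ, (‖α‖ / σ) ^ n * ‖q‖ ^ (n * (n - 1) / 2)), by positivity,
    fun n => ?_⟩
  have h4 := sum_eq_divDiff hq0 hq (fun k => qPoch (α * q ^ n) q k * g k) n 0
  simp only [zero_add, zero_mul, pow_zero, one_mul] at h4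
  rw [h4, norm_mul, divDiff_mul hq0 hq, mul_assoc]
  refine mul_le_mul (h3 n) ?_ (norm_nonneg _) hK
  have hb : ∀ p ∈ Finset.HasAntidiagonal.antidiagonal n,
      ‖divDiff q (qPoch (α * q ^ n) q) p.1 0 * divDiff q g p.2 (0 + p.1)‖ ≤
        C * D * σ ^ n * ((‖α‖ / σ) ^ p.1 * ‖q‖ ^ (p.1 * (p.1 - 1) / 2)) := by
    intro p hp
    have hp := Finset.HasAntidiagonal.mem_antidiagonal.mp hp
    rw [divDiff_qPoch hq0 hq, qPoch_zero, one_mul, norm_mul, div_eq_mul_inv, norm_mul, norm_pow,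
      norm_mul, norm_pow, mul_pow, ← pow_mul]
    have h5 : ‖q‖ ^ (n * p.1) ≤ ‖q‖ ^ (p.1 * (p.1 - 1) / 2) := by
      refine pow_le_pow_of_le_one hqn.le hq.le ?_
      refine (Nat.div_le_self _ _).trans ?_
      rw [mul_comm n]
      exact Nat.mul_le_mul_left _ (by omega)
    have e : ‖α‖ ^ p.1 = (‖α‖ / σ) ^ p.1 * σ ^ p.1 := by
      rw [← mul_pow, div_mul_cancel₀ _ hσ0.ne']
    have e' : σ ^ n = σ ^ p.1 * σ ^ p.2 := by rw [← pow_add, hp]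
    have h6 := h2 p.1
    have h7 := h1 p.2 (0 + p.1)
    rw [e, e']
    calc _ ≤ (‖α‖ / σ) ^ p.1 * σ ^ p.1 * ‖q‖ ^ (p.1 * (p.1 - 1) / 2) * D * (C * σ ^ p.2) := by
          gcongr
      _ = _ := by ring
  refine (norm_sum_le_of_le _ hb).trans ?_
  rw [← Finset.mul_sum, Finset.Nat.sum_antidiagonal_eq_sum_range_succ_mk]
  have h8 := hs.sum_le_tsum (Finset.range n.succ) fun n _ => by positivity
  exact (mul_le_mul_of_nonneg_left h8 (by positivity)).trans_eq (by ring)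

/-! ### Analyticity in the parameter and uniform bounds for the terms. -/

theorem differentiable_qPochInf {q : ℂ} (hq : ‖q‖ < 1) :
    Differentiable ℂ fun x => qPochInf x q := by
  intro x
  have hs : Summable fun k : ℕ => (‖x‖ + 1) * ‖q‖ ^ k :=
    (summable_geometric_of_lt_one (norm_nonneg q) hq).mul_left _
  have h : HasProdLocallyUniformlyOn (fun (k : ℕ) (y : ℂ) => 1 + -(y * q ^ k))
      (fun y => ∏' k : ℕ, (1 + -(y * q ^ k))) (Metric.ball 0 (‖x‖ + 1)) := by
    refine hs.hasProdLocallyUniformlyOn_nat_one_add Metric.isOpen_ball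
      (Eventually.of_forall fun n y hy => ?_) fun n => by fun_prop
    rw [norm_neg, norm_mul, norm_pow]
    have := (mem_ball_zero_iff.mp hy).le
    gcongr
  have h2 := h.differentiableOn
    (.of_forall fun _ => by
      simpa [Finset.prod_fn] using DifferentiableOn.finsetProd (fun _ _ => by fun_prop))
    Metric.isOpen_ball
  simp only [← sub_eq_add_neg] at h2
  exact h2.differentiableAt (Metric.isOpen_ball.mem_nhds (by simp))

theorem qPochInf_eq_mul (a : ℂ) {q : ℂ} (hq : ‖q‖ < 1) (N : ℕ) :
    qPochInf a q = qPoch a q N * qPochInf (a * q ^ N) q := by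
  refine tendsto_nhds_unique ((tendsto_add_atTop_iff_nat N).mpr (tendsto_qPoch a hq)) ?_
  simp_rw [add_comm _ N, qPoch_add]
  exact (tendsto_qPoch _ hq).const_mul _

theorem qPochInf_zero_left (q : ℂ) : qPochInf 0 q = 1 := by simp [qPochInf]

/-- The polynomial `∏_{i=1}^n (a - q^i) / q`, equal to `(q / a; q)_n (a / q)^n` for `a ≠ 0`. -/
noncomputable def nodePoly (q a : ℂ) (n : ℕ) : ℂ := ∏ i ∈ Finset.range n, ((a - q ^ (i + 1)) / q)

theorem nodePoly_eq {q a : ℂ} (ha : a ≠ 0) (n : ℕ) :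
    nodePoly q a n = qPoch (q / a) q n * (a / q) ^ n := by
  have h : ∀ i ∈ Finset.range n, (a - q ^ (i + 1)) / q = (1 - q / a * q ^ i) * (a / q) := by
    intro i _
    field_simp
    ring
  rw [nodePoly, qPoch, Finset.prod_congr rfl h, Finset.prod_mul_distrib, Finset.prod_const,
    Finset.card_range]

theorem nodePoly_zero {q : ℂ} (hq0 : q ≠ 0) (n : ℕ) :
    nodePoly q 0 n = (-1) ^ n * q ^ (n * (n - 1) / 2) := by
  have h : ∀ i ∈ Finset.range n, (0 - q ^ (i + 1)) / q = -1 * q ^ i := by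
    intro i _
    field_simp
    ring
  rw [nodePoly, Finset.prod_congr rfl h, Finset.prod_mul_distrib, Finset.prod_pow_eq_pow_sum,
    Finset.sum_range_id, Finset.prod_const, Finset.card_range]

theorem nodePoly_pow_succ {q : ℂ} (hq0 : q ≠ 0) (N n : ℕ) :
    nodePoly q (q ^ (N + 1)) n = qPoch (q ^ N)⁻¹ q n * (q ^ N) ^ n := by
  rw [nodePoly_eq (pow_ne_zero _ hq0), pow_succ, mul_div_cancel_right₀ _ hq0,
    div_mul_cancel_right₀ hq0]

theorem termPhi_eq_sum {m : ℕ} {q : ℂ} (hq0 : q ≠ 0) (α b : ℂ) (bs cs : Fin m → ℂ) (l n : ℕ) :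
    termPhi q α b bs cs (q ^ (l + 1)) n =
      ∑ k ∈ Finset.range (n + 1), qPoch (q ^ n)⁻¹ q k * q ^ k / qPoch q q k *
        (qPoch (α * q ^ n) q k * hypSeq q α b bs cs l k) := by
  have h : ∀ k, basicHypTerm (r := m + 2) (s := m + 1)
      (Matrix.vecCons (q ^ (-(n : ℤ))) (Matrix.vecCons (α * q ^ n) fun j => α * cs j))
      (Matrix.vecCons (α * b) fun j => α * bs j) q (q ^ (l + 1)) k =
      qPoch (q ^ n)⁻¹ q k * q ^ k / qPoch q q k *
        (qPoch (α * q ^ n) q k * hypSeq q α b bs cs l k) := by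
    intro k
    -- The series is balanced (`r = s + 1`), so the sign and quadratic power of `q` disappear.
    have e : 1 + ((m + 1 : ℕ) : ℤ) - ((m + 2 : ℕ) : ℤ) = 0 := by push_cast; ring
    rw [basicHypTerm, e, zpow_zero, hypSeq]
    simp only [Fin.prod_univ_succ, Matrix.cons_val_zero, Matrix.cons_val_succ, zpow_neg,
      zpow_natCast, Finset.prod_const, Finset.card_range, Finset.prod_inv_distrib]
    rw [← pow_mul, ← pow_mul, mul_comm (l + 1), mul_add, pow_add]
    simp only [div_eq_mul_inv, mul_inv]
    ring
  rw [termPhi, basicHyp, tsum_eq_sum (s := Finset.range (n + 1))]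
  · exact Finset.sum_congr rfl fun k _ => h k
  · intro k hk
    rw [Finset.mem_range, not_lt] at hk
    rw [h, qPoch_inv_pow_eq_zero hq0 hk]
    simp

theorem exists_norm_wellPoised_le (α : ℂ) {q : ℂ} (hq : ‖q‖ < 1) :
    ∃ C, 0 ≤ C ∧ ∀ n, ‖wellPoised α q n‖ ≤ C := by
  obtain ⟨C, hC, h1⟩ := exists_norm_qPoch_le (α * q) hq
  obtain ⟨D, hD, h2⟩ := exists_norm_inv_qPoch_le hq (mul_pow_ne_one hq hq)
  refine ⟨1 + (1 + ‖α‖) * C * D, by positivity, fun n => ?_⟩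
  unfold wellPoised
  split_ifs with h
  · rw [norm_one]
    have : 0 ≤ (1 + ‖α‖) * C * D := by positivity
    linarith
  · have h3 : ‖1 - α * q ^ (2 * n)‖ ≤ 1 + ‖α‖ := by
      refine (norm_sub_le _ _).trans ?_
      rw [norm_one, norm_mul, norm_pow]
      have := mul_le_of_le_one_right (norm_nonneg α)
        (pow_le_one₀ (n := 2 * n) (norm_nonneg q) hq.le)
      linarith
    rw [div_eq_mul_inv, norm_mul, norm_mul]
    have h4 := h1 (n - 1)
    have h5 := h2 n
    calc _ ≤ (1 + ‖α‖) * C * D := by gcongr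
      _ ≤ _ := by linarith

theorem exists_norm_nodePoly_le {q : ℂ} (hq0 : q ≠ 0) (hq : ‖q‖ < 1) {r : ℝ} (hr : 0 < r) :
    ∃ C, 0 ≤ C ∧ ∀ a : ℂ, ‖a‖ ≤ r → ∀ n, ‖nodePoly q a n‖ ≤ C * (r / ‖q‖) ^ n := by
  have hqn := norm_pos_iff.mpr hq0
  have hq' : ‖(‖q‖ : ℂ)‖ < 1 := by simpa using hq
  -- Each factor satisfies `|a - q ^ (i+1)| / |q| ≤ (r / |q|) (1 + (|q| / r) |q| ^ i)`, which gives
  -- this parameter.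
  obtain ⟨C, hC, h⟩ := exists_norm_qPoch_le (-((‖q‖ / r : ℝ) : ℂ)) hq'
  refine ⟨C, hC, fun a ha n => ?_⟩
  refine le_trans ?_ (mul_le_mul_of_nonneg_right (h n) (by positivity))
  rw [nodePoly, qPoch, norm_prod, norm_prod, ← Finset.card_range n, ← Finset.prod_const,
    Finset.card_range, ← Finset.prod_mul_distrib]
  refine Finset.prod_le_prod (fun _ _ => norm_nonneg _) fun i _ => ?_
  have e : (1 : ℂ) - -((‖q‖ / r : ℝ) : ℂ) * (‖q‖ : ℂ) ^ i =
      ((1 + ‖q‖ / r * ‖q‖ ^ i : ℝ) : ℂ) := by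
    push_cast
    ring
  rw [e, Complex.norm_of_nonneg (by positivity), norm_div]
  have h2 : ‖a - q ^ (i + 1)‖ ≤ r + ‖q‖ ^ (i + 1) := by
    refine (norm_sub_le _ _).trans ?_
    rw [norm_pow]
    linarith
  calc _ ≤ (r + ‖q‖ ^ (i + 1)) / ‖q‖ := by gcongr
    _ = _ := by
      field_simp
      ring

/-- Factor by factor, the worst case on the disc is `(ρ; |q|)_n`. -/
theorem exists_norm_inv_qPoch_le_of_norm_le {q : ℂ} (hq : ‖q‖ < 1) {ρ : ℝ} (hρ0 : 0 ≤ ρ)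
    (hρ : ρ < 1) : ∃ C, 0 ≤ C ∧ ∀ x : ℂ, ‖x‖ ≤ ρ → ∀ n, ‖(qPoch x q n)⁻¹‖ ≤ C := by
  have hq' : ‖(‖q‖ : ℂ)‖ < 1 := by simpa using hq
  have hρ' : ‖(ρ : ℂ)‖ < 1 := by simpa [abs_of_nonneg hρ0] using hρ
  obtain ⟨C, hC, h⟩ := exists_norm_inv_qPoch_le hq' (mul_pow_ne_one hρ' hq')
  refine ⟨C, hC, fun x hx n => le_trans ?_ (h n)⟩
  rw [qPoch, qPoch, ← Finset.prod_inv_distrib, ← Finset.prod_inv_distrib, norm_prod, norm_prod]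
  refine Finset.prod_le_prod (fun _ _ => norm_nonneg _) fun i _ => ?_
  have h1 : ρ * ‖q‖ ^ i < 1 :=
    mul_lt_one_of_nonneg_of_lt_one_left hρ0 hρ (pow_le_one₀ (norm_nonneg _) hq.le)
  have e : (1 : ℂ) - (ρ : ℂ) * (‖q‖ : ℂ) ^ i = ((1 - ρ * ‖q‖ ^ i : ℝ) : ℂ) := by
    push_cast
    ring
  rw [e, norm_inv, norm_inv, Complex.norm_of_nonneg (by linarith)]
  refine inv_anti₀ (by linarith) ?_
  have h2 := norm_sub_norm_le 1 (x * q ^ i)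
  rw [norm_one, norm_mul, norm_pow] at h2
  have h3 : ‖x‖ * ‖q‖ ^ i ≤ ρ * ‖q‖ ^ i := by gcongr
  linarith

/-- The strict hypotheses at `a` persist on a slightly larger disc of radius `r`; the eventual
geometric ratio is `σ * r / ‖q‖`. -/
theorem exists_radii {m : ℕ} {q α a : ℂ} (hq0 : q ≠ 0) {cs : Fin m → ℂ} (ha : ‖α * a‖ < 1)
    (hac : ∀ j, ‖α * a * cs j / q‖ < 1) :
    ∃ ρ σ r : ℝ, 0 ≤ ρ ∧ ρ < σ ∧ ‖a‖ < r ∧ ‖α‖ * r < 1 ∧ σ * r < ‖q‖ ∧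
      ∀ j, ‖α * cs j‖ ≤ ρ := by
  have hqn := norm_pos_iff.mpr hq0
  obtain ⟨ρ, hρ0, hρa, hρ⟩ : ∃ ρ : ℝ, 0 ≤ ρ ∧ ρ * ‖a‖ < ‖q‖ ∧ ∀ j, ‖α * cs j‖ ≤ ρ := by
    rcases isEmpty_or_nonempty (Fin m) with h | h
    · exact ⟨0, le_rfl, by simpa using hqn, fun j => h.elim j⟩
    · obtain ⟨i, hi⟩ := Finite.exists_max fun j => ‖α * cs j‖
      refine ⟨‖α * cs i‖, norm_nonneg _, ?_, hi⟩
      have := hac i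
      rwa [norm_div, div_lt_one hqn, mul_right_comm, norm_mul] at this
  have h1 : ∀ᶠ r in 𝓝[>] ‖a‖, ‖α‖ * r < 1 := by
    refine eventually_nhdsWithin_of_eventually_nhds
      (ContinuousAt.eventually_lt (by fun_prop) (by fun_prop) ?_)
    rwa [← norm_mul]
  have h2 : ∀ᶠ r in 𝓝[>] ‖a‖, ρ * r < ‖q‖ :=
    eventually_nhdsWithin_of_eventually_nhds
      (ContinuousAt.eventually_lt (by fun_prop) (by fun_prop) hρa)
  obtain ⟨r, hr1, hr2, hr⟩ := (h1.and (h2.and self_mem_nhdsWithin)).exists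
  have hr0 : 0 < r := (norm_nonneg a).trans_lt hr
  obtain ⟨σ, hσ1, hσ2⟩ := exists_between ((lt_div_iff₀ hr0).mpr hr2)
  exact ⟨ρ, σ, r, hρ0, hσ1, hr, hr1, (lt_div_iff₀ hr0).mp hσ2, hρ⟩

/-! ### The product side. -/

/-- The product side of the expansion. -/
noncomputable def productSide {m : ℕ} (q α b : ℂ) (bs cs : Fin m → ℂ) (l : ℕ) (a : ℂ) : ℂ :=
  (a / q) ^ l *
    (qPochInf (α * q) q * qPochInf (α * a * b / q) q /
      (qPochInf (α * a) q * qPochInf (α * b) q)) *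
    ∏ j, (qPochInf (α * a * bs j / q) q * qPochInf (α * cs j) q /
      (qPochInf (α * a * cs j / q) q * qPochInf (α * bs j) q))

theorem productSide_pow_succ {m : ℕ} {q α b : ℂ} {bs cs : Fin m → ℂ} (l : ℕ) {N : ℕ}
    (hq0 : q ≠ 0) (hq : ‖q‖ < 1) (ha : ‖α * q ^ (N + 1)‖ < 1) (hb : ‖α * b‖ < 1)
    (hbs : ∀ j, ‖α * bs j‖ < 1) (hcs : ∀ j, ‖α * q ^ (N + 1) * cs j / q‖ < 1) :
    productSide q α b bs cs l (q ^ (N + 1)) = qPoch (α * q) q N * hypSeq q α b bs cs l N := by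
  -- Each parameter is shifted by exactly `q ^ N`, so quotients of infinite products become finite
  -- ones of length `N`.
  have e : ∀ x : ℂ, α * q ^ (N + 1) * x / q = α * x * q ^ N := by
    intro x
    field_simp
    ring
  have hB : ∀ x : ℂ, ‖α * x‖ < 1 →
      qPochInf (α * x * q ^ N) q / qPochInf (α * x) q = (qPoch (α * x) q N)⁻¹ := by
    intro x hx
    have h1 := qPochInf_ne_zero hq (mul_pow_ne_one hx hq)
    rw [qPochInf_eq_mul (α * x) hq N] at h1 ⊢
    rw [div_mul_cancel_right₀ (right_ne_zero_of_mul h1)]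
  have h1 : qPochInf (α * q) q / qPochInf (α * q ^ (N + 1)) q = qPoch (α * q) q N := by
    have h2 := qPochInf_ne_zero hq (mul_pow_ne_one ha hq)
    rw [qPochInf_eq_mul (α * q) hq N, show α * q * q ^ N = α * q ^ (N + 1) by ring,
      mul_div_cancel_right₀ _ h2]
  have hprod : ∀ j, qPochInf (α * q ^ (N + 1) * bs j / q) q * qPochInf (α * cs j) q /
      (qPochInf (α * q ^ (N + 1) * cs j / q) q * qPochInf (α * bs j) q) =
      qPoch (α * cs j) q N * (qPoch (α * bs j) q N)⁻¹ := by
    intro j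
    have h2 := qPochInf_ne_zero hq (mul_pow_ne_one (hcs j) hq)
    rw [← hB _ (hbs j), qPochInf_eq_mul (α * cs j) hq N]
    rw [e] at h2 ⊢
    rw [e]
    generalize qPochInf (α * cs j * q ^ N) q = X at *
    field_simp
  rw [productSide, Finset.prod_congr rfl fun j _ => hprod j, Finset.prod_mul_distrib, hypSeq, e,
    ← h1, ← hB _ hb, Finset.prod_const, Finset.card_range, pow_succ, mul_div_cancel_right₀ _ hq0]
  ring

theorem differentiableOn_productSide {m : ℕ} {q α b : ℂ} {bs cs : Fin m → ℂ} (l : ℕ)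
    (hq : ‖q‖ < 1) {U : Set ℂ} (ha : ∀ a ∈ U, ‖α * a‖ < 1) (hb : ‖α * b‖ < 1)
    (hbs : ∀ j, ‖α * bs j‖ < 1) (hcs : ∀ a ∈ U, ∀ j, ‖α * a * cs j / q‖ < 1) :
    DifferentiableOn ℂ (productSide q α b bs cs l) U := by
  have hd : ∀ f : ℂ → ℂ, Differentiable ℂ f → DifferentiableOn ℂ (fun a => qPochInf (f a) q) U :=
    fun f hf => ((differentiable_qPochInf hq).comp hf).differentiableOn
  have hne : ∀ x : ℂ, ‖x‖ < 1 → qPochInf x q ≠ 0 := fun x hx =>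
    qPochInf_ne_zero hq (mul_pow_ne_one hx hq)
  unfold productSide
  refine DifferentiableOn.fun_mul (DifferentiableOn.fun_mul (by fun_prop)
    (DifferentiableOn.fun_div ((hd _ (by fun_prop)).const_mul _) ((hd _ (by fun_prop)).mul_const _)
      fun a h => mul_ne_zero (hne _ (ha a h)) (hne _ hb))) ?_
  refine DifferentiableOn.fun_finsetProd fun j _ => ?_
  exact DifferentiableOn.fun_div ((hd _ (by fun_prop)).mul_const _)
    ((hd _ (by fun_prop)).mul_const _)
    fun a h => mul_ne_zero (hne _ (hcs a h j)) (hne _ (hbs j))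

/-! ### The expansion by the identity theorem, and its special cases. -/

theorem hasSum_productSide {m : ℕ} {q α b a : ℂ} {bs cs : Fin m → ℂ} (l : ℕ)
    (hq0 : q ≠ 0) (hq : ‖q‖ < 1) (ha : ‖α * a‖ < 1) (hb : ‖α * b‖ < 1)
    (hbs : ∀ j, ‖α * bs j‖ < 1) (hcs : ∀ j, ‖α * a * cs j / q‖ < 1) :
    HasSum (fun n : ℕ => wellPoised α q n * nodePoly q a n / qPoch (α * a) q n *
        termPhi q α b bs cs (q ^ (l + 1)) n) (productSide q α b bs cs l a) := by
  have hqn := norm_pos_iff.mpr hq0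
  obtain ⟨ρ, σ, r, hρ0, hρσ, har, hαr, hσr, hρ⟩ := exists_radii hq0 ha hcs
  have hσ0 : 0 < σ := hρ0.trans_lt hρσ
  have hr0 : 0 < r := (norm_nonneg a).trans_lt har
  have hU1 : ∀ x ∈ Metric.ball (0 : ℂ) r, ‖α * x‖ ≤ ‖α‖ * r := by
    intro x hx
    rw [norm_mul]
    have := (mem_ball_zero_iff.mp hx).le
    gcongr
  have hU2 : ∀ x ∈ Metric.ball (0 : ℂ) r, ‖α * x‖ < 1 := fun x hx => (hU1 x hx).trans_lt hαr
  have hU3 : ∀ x ∈ Metric.ball (0 : ℂ) r, ∀ j, ‖α * x * cs j / q‖ < 1 := by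
    intro x hx j
    rw [norm_div, div_lt_one hqn, mul_right_comm, norm_mul]
    refine lt_of_le_of_lt ?_ hσr
    have h1 := (mem_ball_zero_iff.mp hx).le
    have h2 := (hρ j).trans hρσ.le
    gcongr
  obtain ⟨W, hW, hw⟩ := exists_norm_wellPoised_le α hq
  obtain ⟨K, hK, hk⟩ := exists_norm_nodePoly_le hq0 hq hr0
  obtain ⟨D, hD, hd⟩ := exists_norm_inv_qPoch_le_of_norm_le hq
    (mul_nonneg (norm_nonneg α) hr0.le) hαr
  obtain ⟨C, hC, hc⟩ := exists_norm_sum_le (α := α) hq0 hq hρ0 hρσ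
    (divDiffBound_hypSeq hq0 hq hρ0 hb hbs hρ l)
  set F : ℕ → ℂ → ℂ := fun n x => wellPoised α q n * nodePoly q x n / qPoch (α * x) q n *
    termPhi q α b bs cs (q ^ (l + 1)) n with hF
  have hbound : ∀ (n : ℕ) (x : ℂ), x ∈ Metric.ball (0 : ℂ) r →
      ‖F n x‖ ≤ W * K * D * C * (σ * r / ‖q‖) ^ n := by
    intro n x hx
    have h1 := hw n
    have h2 := hk x (mem_ball_zero_iff.mp hx).le n
    have h3 := hd _ (hU1 x hx) n
    have h4 := hc n
    rw [← termPhi_eq_sum hq0] at h4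
    simp only [hF]
    rw [div_eq_mul_inv, norm_mul, norm_mul, norm_mul]
    calc _ ≤ W * (K * (r / ‖q‖) ^ n) * D * (C * σ ^ n) := by gcongr
      _ = _ := by
        rw [mul_div_assoc, mul_pow]
        ring
  have hsum : Summable fun n : ℕ => W * K * D * C * (σ * r / ‖q‖) ^ n :=
    (summable_geometric_of_lt_one (by positivity) ((div_lt_one hqn).mpr hσr)).mul_left _
  have hdiff : ∀ n, DifferentiableOn ℂ (F n) (Metric.ball 0 r) := by
    intro n
    refine DifferentiableOn.mul_const (DifferentiableOn.fun_div (DifferentiableOn.const_mul ?_ _)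
      ?_ fun x hx => qPoch_ne_zero (mul_pow_ne_one (hU2 x hx) hq) n) _
    · exact DifferentiableOn.fun_finsetProd fun _ _ => by fun_prop
    · exact DifferentiableOn.fun_finsetProd fun _ _ => by fun_prop
  have hL := Complex.differentiableOn_tsum_of_summable_norm hsum hdiff Metric.isOpen_ball hbound
  have hR := differentiableOn_productSide l hq hU2 hb hbs hU3
  -- The identity theorem needs agreement points accumulating at 0 but different from it.
  have hnodes : Tendsto (fun N : ℕ => q ^ (N + 1)) atTop (𝓝[≠] 0) :=
    tendsto_nhdsWithin_iff.mpr
      ⟨(tendsto_add_atTop_iff_nat 1).mpr (tendsto_pow_atTop_nhds_zero_of_norm_lt_one hq),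
        Eventually.of_forall fun N => pow_ne_zero _ hq0⟩
  have hev : ∀ᶠ N : ℕ in atTop, ∑' n, F n (q ^ (N + 1)) =
      productSide q α b bs cs l (q ^ (N + 1)) := by
    have hmem : ∀ᶠ N : ℕ in atTop, q ^ (N + 1) ∈ Metric.ball (0 : ℂ) r :=
      (hnodes.mono_right nhdsWithin_le_nhds).eventually (Metric.ball_mem_nhds 0 hr0)
    filter_upwards [hmem] with N hN
    rw [productSide_pow_succ l hq0 hq (hU2 _ hN) hb hbs (hU3 _ hN),
      ← bailey_inversion hq0 hq (mul_pow_ne_one (hU2 _ hN) hq),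
      tsum_eq_sum (s := Finset.range (N + 1))]
    · refine Finset.sum_congr rfl fun n _ => ?_
      simp only [hF]
      rw [nodePoly_pow_succ hq0, termPhi_eq_sum hq0, ← mul_assoc (wellPoised α q n)]
    · intro n hn
      rw [Finset.mem_range, not_lt] at hn
      simp only [hF]
      rw [nodePoly_pow_succ hq0, qPoch_inv_pow_eq_zero hq0 hn]
      simp
  have heq := (hL.analyticOnNhd Metric.isOpen_ball).eqOn_of_preconnected_of_frequently_eq
    (hR.analyticOnNhd Metric.isOpen_ball) (convex_ball 0 r).isPreconnected
    (Metric.mem_ball_self hr0) (hnodes.frequently hev.frequently)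
  have hmem : a ∈ Metric.ball (0 : ℂ) r := mem_ball_zero_iff.mpr har
  rw [← heq hmem]
  exact (Summable.of_norm_bounded hsum fun n => hbound n a hmem).hasSum

theorem mainTheorem1 (q : ℝ) (hq0 : 0 < q) (hq1 : q < 1) (m : ℕ)
    (α b : ℂ) (bs cs : Fin m → ℂ) :
    -- the general formula
    (∀ (a : ℂ) (l : ℕ), a ≠ 0 → ‖α * a‖ < 1 → ‖α * b‖ < 1 →
      (∀ j, ‖α * bs j‖ < 1) → (∀ j, ‖α * a * cs j / q‖ < 1) →
      HasSum
        (fun n : ℕ =>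
          wellPoised α q n * qPoch (q / a) q n * (a / q) ^ n / qPoch (α * a) q n *
            termPhi q α b bs cs ((q : ℂ) ^ (l + 1)) n)
        ((a / q) ^ l *
          (qPochInf (α * q) q * qPochInf (α * a * b / q) q /
            (qPochInf (α * a) q * qPochInf (α * b) q)) *
          ∏ j, (qPochInf (α * a * bs j / q) q * qPochInf (α * cs j) q /
            (qPochInf (α * a * cs j / q) q * qPochInf (α * bs j) q)))) ∧
    -- the case `l = 0`
    (∀ a : ℂ, a ≠ 0 → ‖α * a‖ < 1 → ‖α * b‖ < 1 →
      (∀ j, ‖α * bs j‖ < 1) → (∀ j, ‖α * a * cs j / q‖ < 1) →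
      HasSum
        (fun n : ℕ =>
          wellPoised α q n * qPoch (q / a) q n * (a / q) ^ n / qPoch (α * a) q n *
            termPhi q α b bs cs q n)
        (qPochInf (α * q) q * qPochInf (α * a * b / q) q /
            (qPochInf (α * a) q * qPochInf (α * b) q) *
          ∏ j, (qPochInf (α * a * bs j / q) q * qPochInf (α * cs j) q /
            (qPochInf (α * a * cs j / q) q * qPochInf (α * bs j) q)))) ∧
    -- the case `l = 0`, `a = 0`
    (‖α * b‖ < 1 → (∀ j, ‖α * bs j‖ < 1) →
      HasSum
        (fun n : ℕ =>
          wellPoised α q n * (-1) ^ n * (q : ℂ) ^ (n * (n - 1) / 2) *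
            termPhi q α b bs cs q n)
        (qPochInf (α * q) q / qPochInf (α * b) q *
          ∏ j, (qPochInf (α * cs j) q / qPochInf (α * bs j) q))) ∧
    -- the case `l = 0`, `a = 0`, `b = b_1 = ⋯ = b_m = 0`
    (HasSum
        (fun n : ℕ =>
          wellPoised α q n * (-1) ^ n * (q : ℂ) ^ (n * (n - 1) / 2) *
            termPhi q α 0 (fun _ => 0) cs q n)
        (qPochInf (α * q) q * ∏ j, qPochInf (α * cs j) q)) ∧
    -- the case `l = 0`, `a = 0`, `c_1 = ⋯ = c_m = 0`
    (‖α * b‖ < 1 → (∀ j, ‖α * bs j‖ < 1) →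
      HasSum
        (fun n : ℕ =>
          wellPoised α q n * (-1) ^ n * (q : ℂ) ^ (n * (n - 1) / 2) *
            termPhi q α b bs (fun _ => 0) q n)
        (qPochInf (α * q) q /
          (qPochInf (α * b) q * ∏ j, qPochInf (α * bs j) q))) := by
  have hq : (q : ℂ) ≠ 0 := by exact_mod_cast hq0.ne'
  have hqn : ‖(q : ℂ)‖ < 1 := by simpa [abs_of_pos hq0] using hq1
  have h1 : ∀ (a : ℂ) (l : ℕ), a ≠ 0 → ‖α * a‖ < 1 → ‖α * b‖ < 1 →
      (∀ j, ‖α * bs j‖ < 1) → (∀ j, ‖α * a * cs j / q‖ < 1) →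
      HasSum
        (fun n : ℕ =>
          wellPoised α q n * qPoch (q / a) q n * (a / q) ^ n / qPoch (α * a) q n *
            termPhi q α b bs cs ((q : ℂ) ^ (l + 1)) n) (productSide q α b bs cs l a) := by
    intro a l ha hαa hb hbs hcs
    have := hasSum_productSide l hq hqn hαa hb hbs hcs
    simpa only [nodePoly_eq ha, ← mul_assoc] using this
  -- All parameters are quantified afresh so that (4) and (5) are specialisations; with `a = 0` the
  -- conditions on `α a` and `c_j` are trivial.
  have h3 : ∀ (b : ℂ) (bs cs : Fin m → ℂ), ‖α * b‖ < 1 → (∀ j, ‖α * bs j‖ < 1) →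
      HasSum
        (fun n : ℕ =>
          wellPoised α q n * (-1) ^ n * (q : ℂ) ^ (n * (n - 1) / 2) *
            termPhi q α b bs cs q n)
        (qPochInf (α * q) q / qPochInf (α * b) q *
          ∏ j, (qPochInf (α * cs j) q / qPochInf (α * bs j) q)) := by
    intro b bs cs hb hbs
    have := hasSum_productSide (a := 0) (cs := cs) 0 hq hqn (by simp) hb hbs (by simp)
    simpa [productSide, nodePoly_zero hq, qPochInf_zero_left, qPoch, ← mul_assoc] using this
  refine ⟨h1, fun a ha hαa hb hbs hcs => ?_, h3 b bs cs, ?_, fun hb hbs => ?_⟩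
  · simpa [productSide] using h1 a 0 ha hαa hb hbs hcs
  · simpa [qPochInf_zero_left] using h3 0 (fun _ => 0) cs (by simp) (by simp)
  · simpa [qPochInf_zero_left, div_eq_mul_inv, mul_assoc, -mul_inv_rev, mul_inv] using h3 b bs (fun _ => 0) hb hbs
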